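/- Let $n\ge 1$ and let $b$ be a (real- or complex-valued) locally integrable function on $\mathbb{R}^n$. For a ball $B$ with radius $r(B)$ and Lebesgue measure $|B|$ put $b_B=\frac1{|B|}\int_B b$, and let $c_B=b_B$ if $r(B)<1$ and $c_B=0$ if $r(B)\ge 1$. We say that $b\in\mathrm{bmo}(\mathbb{R}^n)$ if $$\|b\|_{\mathrm{bmo}}:=\sup_B\frac1{|B|}\int_B|b(x)-c_B|\,dx<\infty,$$ the supremum being over all balls, and that $b\in\mathrm{lmo}(\mathbb{R}^n)$ if $b\in\mathrm{bmo}(\mathbb{R}^n)$ and $$\sup_{r(B)<1}\frac{\log(1+r(B)^{-1})}{|B|}\int_B|b(x)-b_B|\,dx<\infty.$$ For a locally integrable function $f$ on $\mathbb{R}^n$ let $$\|f\|_{h^1}:=\int_{\mathbb{R}^n}\mathcal{M}f(x)\,dx\in[0,\infty],\qquad \mathcal{M}f(x):=\sup_\phi\left|\int f\phi\right|,$$ where the supremum is over all $\phi\in C^1(\mathbb{R}^n)$ for which there is $0<t<1$ with $\operatorname{supp}\phi\subset B(x,t)$, $\|\phi\|_{L^\infty}\le|B(x,t)|^{-1}$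 and $\|\nabla\phi\|_{L^\infty}\le[t\,|B(x,t)|]^{-1}$. Let $b\in\mathrm{bmo}(\mathbb{R}^n)$. Then $b\in\mathrm{lmo}(\mathbb{R}^n)$ if and only if $$A_b:=\sup_{r(B)<1}\frac1{|B|}\bigl\||b-b_B|\chi_B\bigr\|_{h^1}+\sup_{r(B)\ge1}\frac1{|B|}\bigl\||b|\chi_B\bigr\|_{h^1}<\infty.$$ -/

import Mathlib

open MeasureTheory Metric Set
open scoped ENNReal

namespace LocalHardy

noncomputable section

/-- Normalized test functions for the local grand maximal function at the point `x`, at scales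
`0 < t < 1`: `C¹` functions `φ` with `supp φ ⊆ B(x, t)`, `‖φ‖_∞ ≤ |B(x, t)|⁻¹` and
`‖∇φ‖_∞ ≤ (t |B(x, t)|)⁻¹`. The operator norm of the derivative is the Euclidean norm of the
gradient. -/
structure IsTestFunction {n : ℕ} (x : EuclideanSpace ℝ (Fin n)) (t : ℝ)
    (φ : EuclideanSpace ℝ (Fin n) → ℝ) : Prop where
  contDiff : ContDiff ℝ 1 φ
  pos : 0 < t
  lt_one : t < 1
  tsupport_subset : tsupport φ ⊆ ball x t
  abs_le : ∀ y, |φ y| ≤ (volume.real (ball x t))⁻¹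
  norm_fderiv_le : ∀ y, ‖fderiv ℝ φ y‖ ≤ (t * volume.real (ball x t))⁻¹

/-- The local grand maximal function `𝓜 f (x) = sup_φ |⟨f, φ⟩|` of a locally integrable function
`f`, with `⟨f, φ⟩ = ∫ f φ`; the supremum runs over all normalized test functions at `x`, at all
scales `0 < t < 1`, and is taken in `[0, ∞]`. -/
def grandMaximal {n : ℕ} (f : EuclideanSpace ℝ (Fin n) → ℝ) (x : EuclideanSpace ℝ (Fin n)) :
    ℝ≥0∞ :=
  ⨆ (t : ℝ) (φ : EuclideanSpace ℝ (Fin n) → ℝ) (_ : IsTestFunction x t φ), ‖∫ y, f y * φ y‖ₑ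

/-- The norm `‖f‖_{h¹} = ‖𝓜 f‖_{L¹}` of the local Hardy space, with values in `[0, ∞]`. -/
def h1Norm {n : ℕ} (f : EuclideanSpace ℝ (Fin n) → ℝ) : ℝ≥0∞ :=
  ∫⁻ x, grandMaximal f x

variable {𝕜 : Type*} [RCLike 𝕜] {n : ℕ}

/-- The average `b_B` over the ball `B = B(x, r)`. -/
def ballAverage (b : EuclideanSpace ℝ (Fin n) → 𝕜) (x : EuclideanSpace ℝ (Fin n)) (r : ℝ) : 𝕜 :=
  ⨍ y in ball x r, b y

open Classical in
/-- The constant `c_B` for `B = B(x, r)`: it is `b_B` if `r < 1`, and `0` if `r ≥ 1`. -/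
def ballConst (b : EuclideanSpace ℝ (Fin n) → 𝕜) (x : EuclideanSpace ℝ (Fin n)) (r : ℝ) : 𝕜 :=
  if r < 1 then ballAverage b x r else 0

/-- `‖b‖_bmo = sup_B ⨍_B |b - c_B|`, over all balls, with values in `[0, ∞]`. -/
def bmoNorm (b : EuclideanSpace ℝ (Fin n) → 𝕜) : ℝ≥0∞ :=
  ⨆ (x : EuclideanSpace ℝ (Fin n)) (r : ℝ) (_ : 0 < r),
    (∫⁻ y in ball x r, ‖b y - ballConst b x r‖ₑ) / volume (ball x r)

/-- `b ∈ bmo(ℝⁿ)`. -/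
def MemBmo (b : EuclideanSpace ℝ (Fin n) → 𝕜) : Prop :=
  LocallyIntegrable b ∧ bmoNorm b < ⊤

/-- `‖b‖_{LMO_loc} = sup_{r(B) < 1} log(1 + r(B)⁻¹) ⨍_B |b - b_B|`, with values in `[0, ∞]`. -/
def lmoLocNorm (b : EuclideanSpace ℝ (Fin n) → 𝕜) : ℝ≥0∞ :=
  ⨆ (x : EuclideanSpace ℝ (Fin n)) (r : ℝ) (_ : 0 < r) (_ : r < 1),
    ENNReal.ofReal (Real.log (1 + r⁻¹)) *
      ((∫⁻ y in ball x r, ‖b y - ballAverage b x r‖ₑ) / volume (ball x r))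

/-- `b ∈ LMO_loc(ℝⁿ)`. -/
def MemLmoLoc (b : EuclideanSpace ℝ (Fin n) → 𝕜) : Prop :=
  LocallyIntegrable b ∧ lmoLocNorm b < ⊤

/-- `lmo(ℝⁿ) = LMO_loc(ℝⁿ) ∩ bmo(ℝⁿ)`. -/
def MemLmo (b : EuclideanSpace ℝ (Fin n) → 𝕜) : Prop :=
  MemLmoLoc b ∧ MemBmo b

/-- The quantity `A_b = sup_{r(B) < 1} |B|⁻¹ ‖|b - b_B| χ_B‖_{h¹} + sup_{r(B) ≥ 1} |B|⁻¹ ‖|b| χ_B‖_{h¹}`,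
with values in `[0, ∞]`. -/
def lmoConst (b : EuclideanSpace ℝ (Fin n) → 𝕜) : ℝ≥0∞ :=
  (⨆ (x : EuclideanSpace ℝ (Fin n)) (r : ℝ) (_ : 0 < r) (_ : r < 1),
    h1Norm ((ball x r).indicator fun y => ‖b y - ballAverage b x r‖) / volume (ball x r)) +
  ⨆ (x : EuclideanSpace ℝ (Fin n)) (r : ℝ) (_ : 1 ≤ r),
    h1Norm ((ball x r).indicator fun y => ‖b y‖) / volume (ball x r)

end

end LocalHardy

open MeasureTheory Metric Set
open scoped ENNReal

namespace LocalHardy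

variable {𝕜 : Type*} [RCLike 𝕜] {n : ℕ}

/-! For a ball `B = B(z, r)` with `r < 1`, put `I = ∫_B |b - b_B|`. As `|b - b_B| χ_B` is
nonnegative, nothing cancels: at distance `d ≥ 2r` from `z` its grand maximal function is comparable
to `I / d^n` while `d` is small against `1`, and it vanishes for `d ≥ r + 1`. Each dyadic annulus
thus contributes about `I`, and about `log(1 + 1/r)` annuli count. Hence the part of the `h¹` norm
outside `2B` is the `lmo` quantity: `setLIntegral_grandMaximal_far_le` bounds it above,
`natCast_mul_setLIntegral_le_h1Norm` gives the lower bound, and the boundedly many scales lost near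
`1` are absorbed by `bmo`.

The part on `2B` is controlled by `bmo` alone. There the grand maximal function is at most the
centred maximal function of `|b - b_{2B}|` plus constants, and a John–Nirenberg argument run
directly on maximal functions (`volume_largeOscSet_add_le`) makes its level sets decay
geometrically, so its mean is finite (`setLIntegral_maximalOsc_le`). For `r ≥ 1` there is no far
part. -/

/-! ### Mean oscillation over balls, and pairing with test functions -/

theorem volume_ball_natCast_mul (x z : EuclideanSpace ℝ (Fin n)) {m : ℕ} (hm : 0 < m) (t : ℝ) :
    volume (ball x (m * t)) = (m : ℝ≥0∞) ^ n * volume (ball z t) := by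
  rw [Measure.addHaar_ball_mul_of_pos _ _ (by exact_mod_cast hm), Measure.addHaar_ball_center _ z,
    finrank_euclideanSpace_fin, ENNReal.ofReal_pow (by positivity), ENNReal.ofReal_natCast]

theorem volume_ball_ne_zero (x : EuclideanSpace ℝ (Fin n)) {t : ℝ} (ht : 0 < t) :
    volume (ball x t) ≠ 0 :=
  (measure_ball_pos _ _ ht).ne'

theorem volume_ball_ne_top (x : EuclideanSpace ℝ (Fin n)) (t : ℝ) :
    volume (ball x t) ≠ ⊤ :=
  measure_ball_lt_top.ne

/-- The mean oscillation of `b` about the constant `c` over the ball `B(x, r)`. -/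
noncomputable def meanOsc (b : EuclideanSpace ℝ (Fin n) → 𝕜) (c : 𝕜)
    (x : EuclideanSpace ℝ (Fin n)) (r : ℝ) : ℝ≥0∞ :=
  (∫⁻ y in ball x r, ‖b y - c‖ₑ) / volume (ball x r)

theorem meanOsc_mul_volume (b : EuclideanSpace ℝ (Fin n) → 𝕜) (c : 𝕜)
    (x : EuclideanSpace ℝ (Fin n)) {r : ℝ} (hr : 0 < r) :
    meanOsc b c x r * volume (ball x r) = ∫⁻ y in ball x r, ‖b y - c‖ₑ :=
  ENNReal.div_mul_cancel (volume_ball_ne_zero x hr) (volume_ball_ne_top x r)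

theorem meanOsc_le_of_ball_subset (b : EuclideanSpace ℝ (Fin n) → 𝕜) (c : 𝕜)
    {x z : EuclideanSpace ℝ (Fin n)} {r s : ℝ} {m : ℕ} (hm : 0 < m) (hr : 0 < r)
    (hsub : ball x r ⊆ ball z s) (hs : s ≤ m * r) :
    meanOsc b c x r ≤ (m : ℝ≥0∞) ^ n * meanOsc b c z s := by
  have hs0 : 0 < s := by
    rw [← Metric.nonempty_ball (x := z)]
    exact (Metric.nonempty_ball.2 hr).mono hsub
  have hv : volume (ball z s) ≤ (m : ℝ≥0∞) ^ n * volume (ball x r) := by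
    rw [← volume_ball_natCast_mul z x hm]
    exact measure_mono (ball_subset_ball hs)
  rw [meanOsc, ENNReal.div_le_iff (volume_ball_ne_zero x hr) (volume_ball_ne_top x r)]
  calc ∫⁻ y in ball x r, ‖b y - c‖ₑ ≤ ∫⁻ y in ball z s, ‖b y - c‖ₑ := lintegral_mono_set hsub
    _ = meanOsc b c z s * volume (ball z s) := (meanOsc_mul_volume b c z hs0).symm
    _ ≤ meanOsc b c z s * ((m : ℝ≥0∞) ^ n * volume (ball x r)) := by gcongr
    _ = _ := by ring

theorem meanOsc_le_add (b : EuclideanSpace ℝ (Fin n) → 𝕜) (c d : 𝕜)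
    (x : EuclideanSpace ℝ (Fin n)) {r : ℝ} (hr : 0 < r) :
    meanOsc b c x r ≤ meanOsc b d x r + ‖d - c‖ₑ := by
  rw [meanOsc, ENNReal.div_le_iff (volume_ball_ne_zero x hr) (volume_ball_ne_top x r), add_mul,
    meanOsc_mul_volume b d x hr]
  calc ∫⁻ y in ball x r, ‖b y - c‖ₑ ≤ ∫⁻ y in ball x r, (‖b y - d‖ₑ + ‖d - c‖ₑ) := by
        refine lintegral_mono fun y => ?_
        rw [← sub_add_sub_cancel (b y) d c]
        exact enorm_add_le _ _
    _ = _ := by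
      rw [lintegral_add_right _ measurable_const, setLIntegral_const]

theorem integrableOn_ball {b : EuclideanSpace ℝ (Fin n) → 𝕜} (hb : LocallyIntegrable b)
    (x : EuclideanSpace ℝ (Fin n)) (r : ℝ) : IntegrableOn b (ball x r) :=
  (hb.integrableOn_isCompact (isCompact_closedBall x r)).mono_set ball_subset_closedBall

theorem enorm_ballAverage_sub_le {b : EuclideanSpace ℝ (Fin n) → 𝕜} (hb : LocallyIntegrable b)
    (c : 𝕜) (x : EuclideanSpace ℝ (Fin n)) {r : ℝ} (hr : 0 < r) :
    ‖ballAverage b x r - c‖ₑ ≤ meanOsc b c x r := by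
  have h0 : volume.real (ball x r) ≠ 0 :=
    (ENNReal.toReal_pos (volume_ball_ne_zero x hr) (volume_ball_ne_top x r)).ne'
  have h : ballAverage b x r - c = (volume.real (ball x r))⁻¹ • ∫ y in ball x r, (b y - c) := by
    rw [integral_sub (integrableOn_ball hb x r) (integrableOn_const (volume_ball_ne_top x r)),
      setIntegral_const, smul_sub, smul_smul, inv_mul_cancel₀ h0, one_smul, ballAverage,
      setAverage_eq]
  rw [h, enorm_smul, meanOsc, ENNReal.div_eq_inv_mul]
  gcongr
  · rw [Real.enorm_eq_ofReal (by positivity), ENNReal.ofReal_inv_of_pos (by positivity),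
      Measure.real, ENNReal.ofReal_toReal (volume_ball_ne_top x r)]
  · exact enorm_integral_le_lintegral_enorm _

theorem meanOsc_ballConst_le (b : EuclideanSpace ℝ (Fin n) → 𝕜) (x : EuclideanSpace ℝ (Fin n))
    {r : ℝ} (hr : 0 < r) : meanOsc b (ballConst b x r) x r ≤ bmoNorm b :=
  le_iSup_of_le x (le_iSup_of_le r (le_iSup_of_le hr le_rfl))

theorem meanOsc_zero_le (b : EuclideanSpace ℝ (Fin n) → 𝕜) (x : EuclideanSpace ℝ (Fin n))
    {r : ℝ} (hr : 1 ≤ r) : meanOsc b 0 x r ≤ bmoNorm b := by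
  have := meanOsc_ballConst_le b x (zero_lt_one.trans_le hr)
  rwa [ballConst, if_neg hr.not_gt] at this

/-- Makes the oscillation bound uniform over all radii: for `r ≥ 1`, replacing the constant `0` by
the average at most doubles the mean. -/
theorem meanOsc_ballAverage_le {b : EuclideanSpace ℝ (Fin n) → 𝕜} (hb : LocallyIntegrable b)
    (x : EuclideanSpace ℝ (Fin n)) {r : ℝ} (hr : 0 < r) :
    meanOsc b (ballAverage b x r) x r ≤ 2 * bmoNorm b := by
  rcases lt_or_ge r 1 with h | h
  · have := meanOsc_ballConst_le b x hr
    rw [ballConst, if_pos h] at this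
    exact this.trans (le_mul_of_one_le_left zero_le one_le_two)
  · calc meanOsc b (ballAverage b x r) x r
        ≤ meanOsc b 0 x r + ‖0 - ballAverage b x r‖ₑ := meanOsc_le_add _ _ _ _ hr
      _ ≤ meanOsc b 0 x r + meanOsc b 0 x r := by
        gcongr
        rw [← enorm_neg, neg_sub]
        exact enorm_ballAverage_sub_le hb 0 x hr
      _ ≤ bmoNorm b + bmoNorm b := by gcongr <;> exact meanOsc_zero_le b x h
      _ = 2 * bmoNorm b := (two_mul _).symm

/-- Only the support and the sup bound of the test function matter for upper bounds; its gradient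
plays no role. -/
theorem enorm_integral_mul_testFunction_le {x : EuclideanSpace ℝ (Fin n)} {t : ℝ}
    {φ : EuclideanSpace ℝ (Fin n) → ℝ} (hφ : IsTestFunction x t φ)
    (f : EuclideanSpace ℝ (Fin n) → ℝ) :
    ‖∫ y, f y * φ y‖ₑ ≤ (∫⁻ y in ball x t, ‖f y‖ₑ) / volume (ball x t) := by
  have hint : ∫ y, f y * φ y = ∫ y in ball x t, f y * φ y := by
    symm
    refine setIntegral_eq_integral_of_forall_compl_eq_zero fun y hy => ?_
    rw [image_eq_zero_of_notMem_tsupport fun h => hy (hφ.tsupport_subset h), mul_zero]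
  rw [hint, ENNReal.div_eq_inv_mul, ← lintegral_const_mul' _ _
    (ENNReal.inv_ne_top.2 (volume_ball_ne_zero x hφ.pos))]
  refine (enorm_integral_le_lintegral_enorm _).trans (lintegral_mono fun y => ?_)
  rw [enorm_mul, mul_comm]
  gcongr
  rw [Real.enorm_eq_ofReal_abs]
  refine (ENNReal.ofReal_le_ofReal (hφ.abs_le y)).trans_eq ?_
  have h0 : 0 < volume.real (ball x t) :=
    ENNReal.toReal_pos (volume_ball_ne_zero x hφ.pos) (volume_ball_ne_top x t)
  rw [ENNReal.ofReal_inv_of_pos h0, Measure.real, ENNReal.ofReal_toReal (volume_ball_ne_top x t)]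

/-! ### A John–Nirenberg inequality for the maximal function -/

/-- The points of `B(z, R)` at which the centred maximal function of `|b - c|`, over radii at most
`R`, exceeds `lam`. -/
def largeOscSet (b : EuclideanSpace ℝ (Fin n) → 𝕜) (c : 𝕜) (z : EuclideanSpace ℝ (Fin n)) (R : ℝ)
    (lam : ℝ≥0∞) : Set (EuclideanSpace ℝ (Fin n)) :=
  {x ∈ ball z R | ∃ t, 0 < t ∧ t ≤ R ∧ lam < meanOsc b c x t}

theorem meanOsc_double_le {b : EuclideanSpace ℝ (Fin n) → 𝕜} (hb : LocallyIntegrable b)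
    {L : ℝ≥0∞} (hL : ∀ x r, 0 < r → meanOsc b (ballAverage b x r) x r ≤ L)
    (z : EuclideanSpace ℝ (Fin n)) {R : ℝ} (hR : 0 < R) :
    meanOsc b (ballAverage b z R) z (2 * R) ≤ (1 + 2 ^ n) * L := by
  have h2 : 0 < 2 * R := by positivity
  calc meanOsc b (ballAverage b z R) z (2 * R)
      ≤ meanOsc b (ballAverage b z (2 * R)) z (2 * R)
        + ‖ballAverage b z (2 * R) - ballAverage b z R‖ₑ := meanOsc_le_add _ _ _ _ h2
    _ ≤ L + 2 ^ n * L := by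
      gcongr
      · exact hL z _ h2
      · rw [← enorm_neg, neg_sub]
        refine (enorm_ballAverage_sub_le hb _ z hR).trans ?_
        refine (meanOsc_le_of_ball_subset b _ (m := 2) (z := z) (s := 2 * R) two_pos hR
          (ball_subset_ball (by linarith)) (by norm_num)).trans ?_
        push_cast
        gcongr
        exact hL z _ h2
    _ = _ := by ring

/-- Since `B(x, t) ⊆ B(z, 2R)` and `2R ≤ 20t`, enlarging the ball costs `20 ^ n`. This forces
stopping radii to be small against `R`. -/
theorem meanOsc_le_of_comparable_radius {b : EuclideanSpace ℝ (Fin n) → 𝕜}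
    (hb : LocallyIntegrable b)
    {L : ℝ≥0∞} (hL : ∀ x r, 0 < r → meanOsc b (ballAverage b x r) x r ≤ L)
    {x z : EuclideanSpace ℝ (Fin n)} {R t : ℝ} (hx : x ∈ ball z R) (ht : 0 < t) (htR : t ≤ R)
    (hRt : R ≤ 10 * t) :
    meanOsc b (ballAverage b z R) x t ≤ 20 ^ n * ((1 + 2 ^ n) * L) := by
  have h := meanOsc_le_of_ball_subset b (ballAverage b z R) (m := 20) (s := 2 * R) (z := z)
    (by norm_num) ht (ball_subset_ball' (by rw [mem_ball] at hx; linarith))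
    (by push_cast; linarith)
  refine h.trans ?_
  push_cast
  gcongr
  exact meanOsc_double_le hb hL z (ht.trans_le htR)

/-- The threshold at which the exceptional balls occupy at most half of the measure. -/
noncomputable def oscThreshold (n : ℕ) (L : ℝ≥0∞) : ℝ≥0∞ :=
  2 * 6 ^ n * 2 ^ n * 20 ^ n * ((1 + 2 ^ n) * L)

/-- The supremum of the admissible radii need not be attained; any admissible radius above half of
it will do, whence the factor `2`. -/
theorem exists_maximal_radius {P : ℝ → Prop} {R s : ℝ} (hs : 0 < s) (hsR : s ≤ R) (hPs : P s) :
    ∃ t, 0 < t ∧ t ≤ R ∧ P t ∧ ∀ u, 2 * t ≤ u → u ≤ R → ¬ P u := by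
  set T := {t | 0 < t ∧ t ≤ R ∧ P t}
  have hbdd : BddAbove T := ⟨R, fun t ht => ht.2.1⟩
  have hsT : s ∈ T := ⟨hs, hsR, hPs⟩
  have hpos : 0 < sSup T := hs.trans_le (le_csSup hbdd hsT)
  obtain ⟨t, ht, htlt⟩ := exists_lt_of_lt_csSup ⟨s, hsT⟩ (half_lt_self hpos)
  refine ⟨t, ht.1, ht.2.1, ht.2.2, fun u hu huR hP => ?_⟩
  have : u ≤ sSup T := le_csSup hbdd ⟨by linarith [ht.1], huR, hP⟩
  linarith

/-- A stopping-time step. Vitali selects disjoint balls of almost maximal radius on which the mean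
of `|b - c|` exceeds `A`. Raising the level by `(2 ^ n + 1) * A` puts every bad point into the
level-`lam` set of some sixfold enlargement, where `hF` applies; the choice of `A` makes the total
measure of these enlargements at most half that of the original ball. -/
theorem volume_largeOscSet_add_le {b : EuclideanSpace ℝ (Fin n) → 𝕜}
    (hb : LocallyIntegrable b) {L : ℝ≥0∞} (hL0 : L ≠ 0) (hLtop : L ≠ ⊤)
    (hL : ∀ x r, 0 < r → meanOsc b (ballAverage b x r) x r ≤ L) {lam F : ℝ≥0∞}
    (hF : ∀ x r, 0 < r →
      volume (largeOscSet b (ballAverage b x r) x r lam) ≤ F * volume (ball x r))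
    (z : EuclideanSpace ℝ (Fin n)) {R : ℝ} (hR : 0 < R) :
    volume (largeOscSet b (ballAverage b z R) z R (lam + (2 ^ n + 1) * oscThreshold n L)) ≤
      F * 2⁻¹ * volume (ball z R) := by
  set A := oscThreshold n L with hA
  set c := ballAverage b z R with hc
  have hn1 : ∀ m : ℕ, 1 ≤ m → (1 : ℝ≥0∞) ≤ (m : ℝ≥0∞) ^ n := fun m hm =>
    one_le_pow₀ (by exact_mod_cast hm)
  have hA0 : A ≠ 0 := by
    rw [hA, oscThreshold]
    simp [hL0]
  have hAtop : A ≠ ⊤ := by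
    rw [hA, oscThreshold]
    finiteness
  have hbig : ∀ x ∈ ball z R, ∀ t, 0 < t → t ≤ R → R ≤ 10 * t → meanOsc b c x t ≤ A := by
    intro x hx t ht htR hRt
    refine (meanOsc_le_of_comparable_radius hb hL hx ht htR hRt).trans ?_
    rw [hA, oscThreshold]
    have h6 := hn1 6 (by norm_num)
    have h2 := hn1 2 (by norm_num)
    push_cast at h6 h2
    calc 20 ^ n * ((1 + 2 ^ n) * L) = 1 * 1 * 1 * 20 ^ n * ((1 + 2 ^ n) * L) := by ring
      _ ≤ _ := by gcongr; exact one_le_two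
  set S := largeOscSet b c z R A with hS
  have hrad : ∀ x : EuclideanSpace ℝ (Fin n), ∃ t : ℝ, x ∈ S → 0 < t ∧ t ≤ R ∧
      A < meanOsc b c x t ∧ ∀ u, 2 * t ≤ u → u ≤ R → ¬ A < meanOsc b c x u := by
    intro x
    by_cases hx : x ∈ S
    · obtain ⟨s, hs, hsR, hAs⟩ := hx.2
      obtain ⟨t, ht⟩ := exists_maximal_radius (P := fun t => A < meanOsc b c x t) hs hsR hAs
      exact ⟨t, fun _ => ht⟩
    · exact ⟨0, fun h => absurd h hx⟩
  choose ρ hρ using hrad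
  obtain ⟨u, huS, hdisj, hcover⟩ :=
    Vitali.exists_disjoint_subfamily_covering_enlargement_closedBall S id ρ R
      (fun x hx => (hρ x hx).2.1) 5 (by norm_num)
  simp only [id] at hdisj hcover
  have hball : u.PairwiseDisjoint fun x => ball x (ρ x) :=
    hdisj.mono fun x => ball_subset_closedBall
  have hcount : u.Countable := hball.countable_of_isOpen (fun _ _ => isOpen_ball)
    fun x hx => nonempty_ball.2 (hρ x (huS hx)).1
  -- Leaves room for the radius `6 * ρ x` below `R`, so that maximality can be applied to it.
  have hsmall : ∀ x ∈ S, 10 * ρ x < R := by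
    intro x hx
    by_contra! h
    exact (hbig x hx.1 (ρ x) (hρ x hx).1 (hρ x hx).2.1 h).not_gt (hρ x hx).2.2.1
  have hsub : largeOscSet b c z R (lam + (2 ^ n + 1) * A) ⊆
      ⋃ y ∈ u, largeOscSet b (ballAverage b y (6 * ρ y)) y (6 * ρ y) lam := by
    rintro x ⟨hxz, t, ht, htR, hlt⟩
    have hAlt : A ≤ lam + (2 ^ n + 1) * A :=
      (le_mul_of_one_le_left zero_le le_add_self).trans le_add_self
    have hxS : x ∈ S := ⟨hxz, t, ht, htR, hAlt.trans_lt hlt⟩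
    obtain ⟨y, hyu, hy⟩ := hcover x hxS
    have hyS := huS hyu
    obtain ⟨hρ0, hρR, -, hmax⟩ := hρ y hyS
    have hxy : dist x y ≤ 5 * ρ y :=
      mem_closedBall.1 (hy (mem_closedBall_self (hρ x hxS).1.le))
    refine mem_iUnion₂.2 ⟨y, hyu, mem_ball.2 (by linarith), t, ht, ?_, ?_⟩
    -- A radius `t > 6 * ρ y` would put `B(x, t)` inside `B(y, 2t)`, whose mean is at most `A` by
    -- maximality; if `2t > R`, then `t` is comparable to `R` and `hbig` applies.
    · by_contra! h
      refine hlt.not_ge ?_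
      rcases le_total (2 * t) R with h2 | h2
      · have h3 := meanOsc_le_of_ball_subset b c (m := 2) (z := y) (s := 2 * t) two_pos ht
          (ball_subset_ball' (by linarith)) (by norm_num)
        have h4 : meanOsc b c y (2 * t) ≤ A := not_lt.1 (hmax _ (by linarith) h2)
        calc meanOsc b c x t ≤ 2 ^ n * A := h3.trans (by push_cast; gcongr)
          _ ≤ (2 ^ n + 1) * A := by gcongr; exact le_self_add
          _ ≤ _ := le_add_self
      · exact (hbig x hxz t ht htR (by linarith)).trans hAlt
    -- Maximality at radius `6 * ρ y` bounds the cost of recentring from `c` to the new average;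
    -- this uses up the last summand `A` of the level.
    · have h6 : ‖ballAverage b y (6 * ρ y) - c‖ₑ ≤ A :=
        (enorm_ballAverage_sub_le hb c y (by linarith)).trans
          (not_lt.1 (hmax _ (by linarith) (by linarith [hsmall y hyS])))
      have h7 : lam + A < meanOsc b (ballAverage b y (6 * ρ y)) x t + A := by
        calc lam + A ≤ lam + (2 ^ n + 1) * A := by
              gcongr
              exact le_mul_of_one_le_left zero_le le_add_self
          _ < _ := hlt
          _ ≤ _ := meanOsc_le_add b c (ballAverage b y (6 * ρ y)) x ht
          _ ≤ _ := by gcongr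
      exact (ENNReal.add_lt_add_iff_right hAtop).1 h7
  -- Chebyshev's inequality on the disjoint selected balls, all contained in `B(z, 2R)`.
  have hsum : A * ∑' y : u, volume (ball (y : EuclideanSpace ℝ (Fin n)) (ρ y)) ≤
      (1 + 2 ^ n) * L * (2 ^ n * volume (ball z R)) := by
    calc A * ∑' y : u, volume (ball (y : EuclideanSpace ℝ (Fin n)) (ρ y))
        ≤ ∑' y : u, ∫⁻ w in ball (y : EuclideanSpace ℝ (Fin n)) (ρ y), ‖b w - c‖ₑ := by
          rw [← ENNReal.tsum_mul_left]
          refine ENNReal.tsum_le_tsum fun y => ?_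
          have hy := hρ y (huS y.2)
          rw [← meanOsc_mul_volume b c _ hy.1]
          gcongr
          exact hy.2.2.1.le
      _ = ∫⁻ w in ⋃ y ∈ u, ball y (ρ y), ‖b w - c‖ₑ :=
          (lintegral_biUnion hcount (fun _ _ => measurableSet_ball) hball _).symm
      _ ≤ ∫⁻ w in ball z (2 * R), ‖b w - c‖ₑ := by
          refine lintegral_mono_set (iUnion₂_subset fun y hy => ball_subset_ball' ?_)
          have h1 := (hρ y (huS hy)).2.1
          have h2 := mem_ball.1 (huS hy).1
          linarith
      _ = meanOsc b c z (2 * R) * volume (ball z (2 * R)) :=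
          (meanOsc_mul_volume b c z (by positivity)).symm
      _ ≤ _ := by
          gcongr
          · exact meanOsc_double_le hb hL z hR
          · have := volume_ball_natCast_mul z z two_pos R
            push_cast at this
            exact this.le
  calc volume (largeOscSet b c z R (lam + (2 ^ n + 1) * A))
      ≤ volume (⋃ y ∈ u, largeOscSet b (ballAverage b y (6 * ρ y)) y (6 * ρ y) lam) :=
        measure_mono hsub
    _ ≤ ∑' y : u, volume (largeOscSet b (ballAverage b (y : EuclideanSpace ℝ (Fin n)) (6 * ρ y))
          y (6 * ρ y) lam) := measure_biUnion_le _ hcount _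
    _ ≤ ∑' y : u, F * (6 ^ n * volume (ball (y : EuclideanSpace ℝ (Fin n)) (ρ y))) := by
        refine ENNReal.tsum_le_tsum fun y => ?_
        refine (hF y (6 * ρ y) (by linarith [(hρ y (huS y.2)).1])).trans ?_
        have := volume_ball_natCast_mul (y : EuclideanSpace ℝ (Fin n)) y (m := 6) (by norm_num) (ρ y)
        push_cast at this
        rw [this]
    _ = F * 6 ^ n * ∑' y : u, volume (ball (y : EuclideanSpace ℝ (Fin n)) (ρ y)) := by
        rw [← ENNReal.tsum_mul_left]
        simp only [mul_assoc]
    _ ≤ F * 2⁻¹ * volume (ball z R) := by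
        rw [mul_assoc, mul_assoc]
        gcongr F * ?_
        rw [← ENNReal.mul_le_mul_iff_right hA0 hAtop]
        calc A * (6 ^ n * ∑' y : u, volume (ball (y : EuclideanSpace ℝ (Fin n)) (ρ y)))
            = 6 ^ n * (A * ∑' y : u, volume (ball (y : EuclideanSpace ℝ (Fin n)) (ρ y))) := by
              ring
          _ ≤ 6 ^ n * ((1 + 2 ^ n) * L * (2 ^ n * volume (ball z R))) := by gcongr
          _ = (2 * 2⁻¹) * 6 ^ n * 2 ^ n * 1 * ((1 + 2 ^ n) * L) * volume (ball z R) := by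
              rw [ENNReal.mul_inv_cancel two_ne_zero ENNReal.ofNat_ne_top]; ring
          _ ≤ (2 * 2⁻¹) * 6 ^ n * 2 ^ n * 20 ^ n * ((1 + 2 ^ n) * L) * volume (ball z R) := by
              gcongr
              exact_mod_cast hn1 20 (by norm_num)
          _ = A * (2⁻¹ * volume (ball z R)) := by rw [hA, oscThreshold]; ring

theorem volume_largeOscSet_natCast_mul_le {b : EuclideanSpace ℝ (Fin n) → 𝕜}
    (hb : LocallyIntegrable b) {L : ℝ≥0∞} (hL0 : L ≠ 0) (hLtop : L ≠ ⊤)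
    (hL : ∀ x r, 0 < r → meanOsc b (ballAverage b x r) x r ≤ L) (k : ℕ)
    (z : EuclideanSpace ℝ (Fin n)) {R : ℝ} (hR : 0 < R) :
    volume (largeOscSet b (ballAverage b z R) z R (k * ((2 ^ n + 1) * oscThreshold n L))) ≤
      2⁻¹ ^ k * volume (ball z R) := by
  induction k generalizing z R with
  | zero =>
    rw [pow_zero, one_mul]
    exact measure_mono fun x hx => hx.1
  | succ k ih =>
    have := volume_largeOscSet_add_le hb hL0 hLtop hL (fun x r hr => ih x hr) z hR
    rwa [← add_one_mul, ← Nat.cast_succ, ← pow_succ] at this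

/-- A discrete layer-cake bound: the sum is `a` times the number of multiples of `a` below `v`. -/
theorem le_tsum_indicator_mul {a : ℝ≥0∞} (ha : a ≠ 0) (v : ℝ≥0∞) :
    v ≤ ∑' k : ℕ, {w : ℝ≥0∞ | k * a < w}.indicator (fun _ => a) v := by
  by_cases h : ∃ k : ℕ, v ≤ k * a
  · classical
    have hk := Nat.find_spec h
    calc v ≤ Nat.find h * a := hk
      _ = ∑ k ∈ Finset.range (Nat.find h), {w : ℝ≥0∞ | k * a < w}.indicator (fun _ => a) v := by
        rw [Finset.sum_congr rfl (g := fun _ => a), Finset.sum_const, Finset.card_range,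
          nsmul_eq_mul]
        intro k hk
        exact indicator_of_mem (not_le.1 (Nat.find_min h (Finset.mem_range.1 hk))) _
      _ ≤ _ := ENNReal.sum_le_tsum _
  · push Not at h
    have : ∀ k : ℕ, {w : ℝ≥0∞ | k * a < w}.indicator (fun _ => a) v = a := fun k =>
      indicator_of_mem (s := {w : ℝ≥0∞ | k * a < w}) (h k) _
    simp only [this]
    rw [ENNReal.tsum_const_eq_top_of_ne_zero ha]
    exact le_top

/-- The centred maximal function of `|b - c|` over radii at most `R`. -/
noncomputable def maximalOsc (b : EuclideanSpace ℝ (Fin n) → 𝕜) (c : 𝕜) (R : ℝ)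
    (x : EuclideanSpace ℝ (Fin n)) : ℝ≥0∞ :=
  ⨆ (t : ℝ) (_ : 0 < t) (_ : t ≤ R), meanOsc b c x t

theorem setLIntegral_maximalOsc_le {b : EuclideanSpace ℝ (Fin n) → 𝕜}
    (hb : LocallyIntegrable b) {L : ℝ≥0∞} (hL0 : L ≠ 0) (hLtop : L ≠ ⊤)
    (hL : ∀ x r, 0 < r → meanOsc b (ballAverage b x r) x r ≤ L)
    (z : EuclideanSpace ℝ (Fin n)) {R : ℝ} (hR : 0 < R) :
    ∫⁻ x in ball z R, maximalOsc b (ballAverage b z R) R x ≤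
      2 * ((2 ^ n + 1) * oscThreshold n L) * volume (ball z R) := by
  set a := (2 ^ n + 1) * oscThreshold n L with ha
  set c := ballAverage b z R with hc
  have ha0 : a ≠ 0 := by
    rw [ha, oscThreshold]
    simp [hL0]
  -- Measurable hulls have the same measure and allow exchanging sum and integral without proving
  -- the level sets measurable.
  set U : ℕ → Set (EuclideanSpace ℝ (Fin n)) := fun k =>
    toMeasurable volume (largeOscSet b c z R (k * a)) with hU
  have hpt : ∀ x ∈ ball z R, maximalOsc b c R x ≤ ∑' k, (U k).indicator (fun _ => a) x := by
    intro x hx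
    refine iSup_le fun t => iSup_le fun ht => iSup_le fun htR => ?_
    refine (le_tsum_indicator_mul ha0 _).trans (ENNReal.tsum_le_tsum fun k => ?_)
    by_cases hk : k * a < meanOsc b c x t
    · have hxU : x ∈ U k := subset_toMeasurable _ _ ⟨hx, t, ht, htR, hk⟩
      rw [indicator_of_mem hxU]
      exact indicator_le_self' (fun _ _ => zero_le) _
    · rw [indicator_of_notMem (by exact hk)]
      exact zero_le
  calc ∫⁻ x in ball z R, maximalOsc b c R x
      ≤ ∫⁻ x in ball z R, ∑' k, (U k).indicator (fun _ => a) x :=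
        setLIntegral_mono' measurableSet_ball hpt
    _ ≤ ∫⁻ x, ∑' k, (U k).indicator (fun _ => a) x := setLIntegral_le_lintegral _ _
    _ = ∑' k, a * volume (U k) := by
        rw [lintegral_tsum fun k =>
          (measurable_const.indicator (measurableSet_toMeasurable _ _)).aemeasurable]
        simp only [hU, lintegral_indicator_const (measurableSet_toMeasurable _ _)]
    _ ≤ ∑' k : ℕ, a * (2⁻¹ ^ k * volume (ball z R)) := by
        refine ENNReal.tsum_le_tsum fun k => ?_
        gcongr
        rw [hU, measure_toMeasurable]
        exact volume_largeOscSet_natCast_mul_le hb hL0 hLtop hL k z hR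
    _ = 2 * a * volume (ball z R) := by
        rw [ENNReal.tsum_mul_left, ENNReal.tsum_mul_right, ENNReal.tsum_geometric,
          ENNReal.one_sub_inv_two, inv_inv]
        ring

/-! ### Upper bounds for the `h¹` norm -/

theorem setLIntegral_enorm_indicator_norm_sub (b : EuclideanSpace ℝ (Fin n) → 𝕜) (c : 𝕜)
    (z : EuclideanSpace ℝ (Fin n)) (r : ℝ) (s : Set (EuclideanSpace ℝ (Fin n))) :
    ∫⁻ y in s, ‖(ball z r).indicator (fun w => ‖b w - c‖) y‖ₑ =
      ∫⁻ y in ball z r ∩ s, ‖b y - c‖ₑ := by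
  simp only [enorm_indicator_eq_indicator_enorm, enorm_norm]
  rw [lintegral_indicator measurableSet_ball, Measure.restrict_restrict measurableSet_ball]

theorem grandMaximal_indicator_eq_zero (b : EuclideanSpace ℝ (Fin n) → 𝕜) (c : 𝕜)
    {x z : EuclideanSpace ℝ (Fin n)} {r : ℝ} (h : r + 1 ≤ dist x z) :
    grandMaximal ((ball z r).indicator fun w => ‖b w - c‖) x = 0 := by
  refine le_antisymm (iSup_le fun t => iSup_le fun φ => iSup_le fun hφ => ?_) zero_le
  refine (enorm_integral_mul_testFunction_le hφ _).trans ?_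
  rw [setLIntegral_enorm_indicator_norm_sub, (ball_disjoint_ball (δ := r) (ε := t)
    (by rw [dist_comm]; linarith [hφ.lt_one])).inter_eq]
  simp

/-- Test balls of radius at most `s` miss `B(z, r)`, and larger ones have at least the volume of
`B(z, s)`. -/
theorem grandMaximal_indicator_le_of_lt_dist (b : EuclideanSpace ℝ (Fin n) → 𝕜) (c : 𝕜)
    {x z : EuclideanSpace ℝ (Fin n)} {r s : ℝ} (h : r + s ≤ dist x z) :
    grandMaximal ((ball z r).indicator fun w => ‖b w - c‖) x ≤
      (∫⁻ y in ball z r, ‖b y - c‖ₑ) / volume (ball z s) := by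
  refine iSup_le fun t => iSup_le fun φ => iSup_le fun hφ => ?_
  refine (enorm_integral_mul_testFunction_le hφ _).trans ?_
  rw [setLIntegral_enorm_indicator_norm_sub]
  rcases le_total t s with hts | hst
  · rw [(ball_disjoint_ball (δ := r) (ε := t) (by rw [dist_comm]; linarith)).inter_eq]
    simp
  · rw [Measure.addHaar_ball_center _ x, Measure.addHaar_ball_center _ z]
    gcongr
    exact inter_subset_left

/-- Scales up to `R` are seen by the maximal function after recentring at `d`; beyond `R ≥ r` the
test ball is larger than `B(z, r)`, so the mean over the latter suffices. -/
theorem grandMaximal_indicator_le_maximalOsc (b : EuclideanSpace ℝ (Fin n) → 𝕜) (c d : 𝕜)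
    (x z : EuclideanSpace ℝ (Fin n)) {r R : ℝ} (hrR : r ≤ R) :
    grandMaximal ((ball z r).indicator fun w => ‖b w - c‖) x ≤
      maximalOsc b d R x + (‖d - c‖ₑ + meanOsc b c z r) := by
  refine iSup_le fun t => iSup_le fun φ => iSup_le fun hφ => ?_
  refine (enorm_integral_mul_testFunction_le hφ _).trans ?_
  rw [setLIntegral_enorm_indicator_norm_sub]
  rcases le_total t R with ht | ht
  · calc (∫⁻ y in ball z r ∩ ball x t, ‖b y - c‖ₑ) / volume (ball x t)
        ≤ meanOsc b c x t := by
          rw [meanOsc]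
          gcongr
          exact inter_subset_right
      _ ≤ meanOsc b d x t + ‖d - c‖ₑ := meanOsc_le_add _ _ _ _ hφ.pos
      _ ≤ maximalOsc b d R x + (‖d - c‖ₑ + meanOsc b c z r) := by
          gcongr
          · exact le_iSup_of_le t (le_iSup_of_le hφ.pos (le_iSup_of_le ht le_rfl))
          · exact le_self_add
  · calc (∫⁻ y in ball z r ∩ ball x t, ‖b y - c‖ₑ) / volume (ball x t)
        ≤ meanOsc b c z r := by
          rw [meanOsc, Measure.addHaar_ball_center _ x, Measure.addHaar_ball_center _ z]
          gcongr
          · exact inter_subset_left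
          · linarith
      _ ≤ _ := le_add_self.trans le_add_self

theorem setLIntegral_grandMaximal_double_ball_le {b : EuclideanSpace ℝ (Fin n) → 𝕜}
    (hb : LocallyIntegrable b) {L : ℝ≥0∞} (hL0 : L ≠ 0) (hLtop : L ≠ ⊤)
    (hL : ∀ x r, 0 < r → meanOsc b (ballAverage b x r) x r ≤ L) (c : 𝕜)
    (z : EuclideanSpace ℝ (Fin n)) {r : ℝ} (hr : 0 < r) :
    ∫⁻ x in ball z (2 * r), grandMaximal ((ball z r).indicator fun w => ‖b w - c‖) x ≤
      (2 * ((2 ^ n + 1) * oscThreshold n L) + (‖ballAverage b z (2 * r) - c‖ₑ + meanOsc b c z r)) *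
        (2 ^ n * volume (ball z r)) := by
  have h2 : 0 < 2 * r := by positivity
  have hv := volume_ball_natCast_mul z z two_pos r
  push_cast at hv
  rw [← hv, add_mul]
  refine (lintegral_mono fun x => grandMaximal_indicator_le_maximalOsc b c
    (ballAverage b z (2 * r)) x z (R := 2 * r) (by linarith)).trans ?_
  rw [lintegral_add_right _ measurable_const, setLIntegral_const]
  gcongr
  exact setLIntegral_maximalOsc_le hb hL0 hLtop hL z h2

theorem h1Norm_indicator_eq_add (b : EuclideanSpace ℝ (Fin n) → 𝕜) (c : 𝕜)
    (z : EuclideanSpace ℝ (Fin n)) (r R : ℝ) :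
    h1Norm ((ball z r).indicator fun w => ‖b w - c‖) =
      (∫⁻ x in ball z R, grandMaximal ((ball z r).indicator fun w => ‖b w - c‖) x) +
        ∫⁻ x in (ball z R)ᶜ, grandMaximal ((ball z r).indicator fun w => ‖b w - c‖) x :=
  (lintegral_add_compl _ measurableSet_ball).symm

theorem h1Norm_large_ball_le {b : EuclideanSpace ℝ (Fin n) → 𝕜}
    (hb : LocallyIntegrable b) {L : ℝ≥0∞} (hL0 : L ≠ 0) (hLtop : L ≠ ⊤)
    (hL : ∀ x r, 0 < r → meanOsc b (ballAverage b x r) x r ≤ L)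
    (z : EuclideanSpace ℝ (Fin n)) {r : ℝ} (hr : 1 ≤ r) :
    h1Norm ((ball z r).indicator fun w => ‖b w‖) / volume (ball z r) ≤
      (2 * ((2 ^ n + 1) * oscThreshold n L) + (bmoNorm b + bmoNorm b)) * 2 ^ n := by
  have hr0 : 0 < r := by linarith
  rw [ENNReal.div_le_iff (volume_ball_ne_zero z hr0) (volume_ball_ne_top z r)]
  have h := h1Norm_indicator_eq_add b 0 z r (2 * r)
  -- Here `2r ≥ r + 1`, so no test function of scale below `1` reaches the ball.
  have hfar : ∫⁻ x in (ball z (2 * r))ᶜ,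
      grandMaximal ((ball z r).indicator fun w => ‖b w - 0‖) x = 0 := by
    rw [setLIntegral_congr_fun (g := fun _ => 0) measurableSet_ball.compl, lintegral_zero]
    intro x hx
    refine grandMaximal_indicator_eq_zero b 0 ?_
    rw [mem_compl_iff, mem_ball, not_lt] at hx
    linarith
  rw [hfar, add_zero] at h
  simp only [sub_zero] at h
  rw [h]
  have hnear := setLIntegral_grandMaximal_double_ball_le hb hL0 hLtop hL 0 z hr0
  simp only [sub_zero] at hnear
  refine hnear.trans ?_
  rw [mul_assoc]
  gcongr
  · have := enorm_ballAverage_sub_le hb 0 z (r := 2 * r) (by linarith)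
    rw [sub_zero] at this
    exact this.trans (meanOsc_zero_le b z (by linarith))
  · exact meanOsc_zero_le b z hr

theorem exists_two_pow_near_inv {r : ℝ} (hr : 0 < r) (hr1 : r < 1) :
    ∃ m : ℕ, 2 ^ m * r ≤ 1 ∧ 1 < 2 ^ (m + 1) * r := by
  obtain ⟨m, h1, h2⟩ := exists_nat_pow_near (one_le_inv_iff₀.2 ⟨hr, hr1.le⟩) one_lt_two
  exact ⟨m, by rwa [← le_div_iff₀ hr, one_div], by rwa [← div_lt_iff₀ hr, one_div]⟩

/-- The dyadic annulus of inner radius `2 ^ k * r` and outer radius `2 ^ (k + 1) * r`. -/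
def dyadicAnnulus (z : EuclideanSpace ℝ (Fin n)) (r : ℝ) (k : ℕ) : Set (EuclideanSpace ℝ (Fin n)) :=
  ball z (2 ^ (k + 1) * r) \ ball z (2 ^ k * r)

theorem measurableSet_dyadicAnnulus (z : EuclideanSpace ℝ (Fin n)) (r : ℝ) (k : ℕ) :
    MeasurableSet (dyadicAnnulus z r k) :=
  measurableSet_ball.diff measurableSet_ball

theorem setLIntegral_grandMaximal_far_le (b : EuclideanSpace ℝ (Fin n) → 𝕜) (c : 𝕜)
    (z : EuclideanSpace ℝ (Fin n)) {r : ℝ} (hr : 0 < r) (hr1 : r < 1) :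
    ∫⁻ x in (ball z (2 * r))ᶜ, grandMaximal ((ball z r).indicator fun w => ‖b w - c‖) x ≤
      4 * 4 ^ n * (ENNReal.ofReal (Real.log (1 + r⁻¹)) * ∫⁻ y in ball z r, ‖b y - c‖ₑ) := by
  set G := grandMaximal ((ball z r).indicator fun w => ‖b w - c‖) with hG
  set I := ∫⁻ y in ball z r, ‖b y - c‖ₑ with hI
  have hcover : (ball z (2 * r))ᶜ ⊆ ⋃ j, dyadicAnnulus z r (j + 1) := by
    intro x hx
    rw [mem_compl_iff, mem_ball, not_lt] at hx
    obtain ⟨j, h1, h2⟩ := exists_nat_pow_near (x := dist x z / (2 * r)) (y := (2 : ℝ))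
      ((one_le_div (by positivity)).2 hx) one_lt_two
    rw [le_div_iff₀ (by positivity)] at h1
    rw [div_lt_iff₀ (by positivity)] at h2
    refine mem_iUnion.2 ⟨j, mem_ball.2 ?_, fun h => ?_⟩
    · calc dist x z < _ := h2
        _ = _ := by ring
    · rw [mem_ball, pow_succ] at h
      linarith
  have hterm : ∀ j, ∫⁻ x in dyadicAnnulus z r (j + 1), G x ≤ 4 ^ n * I := by
    intro j
    have hj : 0 < 2 ^ j * r := by positivity
    have hj1 : r ≤ 2 ^ j * r := le_mul_of_one_le_left hr.le (one_le_pow₀ one_le_two)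
    calc ∫⁻ x in dyadicAnnulus z r (j + 1), G x
        ≤ ∫⁻ x in dyadicAnnulus z r (j + 1), I / volume (ball z (2 ^ j * r)) := by
          refine setLIntegral_mono' (measurableSet_dyadicAnnulus z r _) fun x hx => ?_
          refine grandMaximal_indicator_le_of_lt_dist b c ?_
          have := hx.2
          rw [mem_ball, not_lt, pow_succ] at this
          linarith
      _ = I / volume (ball z (2 ^ j * r)) * volume (dyadicAnnulus z r (j + 1)) :=
          setLIntegral_const _ _
      _ ≤ I / volume (ball z (2 ^ j * r)) * (4 ^ n * volume (ball z (2 ^ j * r))) := by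
          gcongr
          refine (measure_mono sdiff_subset).trans ?_
          have := volume_ball_natCast_mul z z (m := 4) (by norm_num) (2 ^ j * r)
          push_cast at this
          rw [← this]
          exact measure_mono (ball_subset_ball (by rw [pow_succ, pow_succ]; linarith))
      _ = 4 ^ n * (I / volume (ball z (2 ^ j * r)) * volume (ball z (2 ^ j * r))) := by ring
      _ = 4 ^ n * I := by
          rw [ENNReal.div_mul_cancel (volume_ball_ne_zero z hj) (volume_ball_ne_top z _)]
  obtain ⟨m, hm1, hm2⟩ := exists_two_pow_near_inv hr hr1
  -- For `j ≥ m + 1` the inner radius `2 ^ (j + 1) * r` exceeds `2`, hence `r + 1`.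
  have hzero : ∀ j, j ∉ Finset.range (m + 1) → ∫⁻ x in dyadicAnnulus z r (j + 1), G x = 0 := by
    intro j hj
    rw [Finset.mem_range, not_lt] at hj
    rw [setLIntegral_congr_fun (g := fun _ => 0) (measurableSet_dyadicAnnulus z r _),
      lintegral_zero]
    intro x hx
    refine grandMaximal_indicator_eq_zero b c ?_
    have h := hx.2
    rw [mem_ball, not_lt, pow_succ] at h
    have : (2 : ℝ) ^ (m + 1) * r ≤ 2 ^ j * r := by
      gcongr
      exact one_le_two
    linarith
  have hcard : ((m + 1 : ℕ) : ℝ≥0∞) ≤ 4 * ENNReal.ofReal (Real.log (1 + r⁻¹)) := by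
    have hri : 1 < r⁻¹ := (one_lt_inv₀ hr).2 hr1
    have h1 : (m : ℝ) * Real.log 2 ≤ Real.log (1 + r⁻¹) := by
      rw [← Real.log_pow]
      refine Real.log_le_log (by positivity) ?_
      rw [← le_div_iff₀ hr, one_div] at hm1
      linarith
    have h2 : Real.log 2 ≤ Real.log (1 + r⁻¹) := Real.log_le_log two_pos (by linarith)
    have h3 : ((m + 1 : ℕ) : ℝ) ≤ 4 * Real.log (1 + r⁻¹) := by
      push_cast
      nlinarith [Real.log_two_gt_d9, (Nat.cast_nonneg m : (0 : ℝ) ≤ m)]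
    calc ((m + 1 : ℕ) : ℝ≥0∞) = ENNReal.ofReal ((m + 1 : ℕ) : ℝ) :=
          (ENNReal.ofReal_natCast _).symm
      _ ≤ ENNReal.ofReal (4 * Real.log (1 + r⁻¹)) := ENNReal.ofReal_le_ofReal h3
      _ = _ := by rw [ENNReal.ofReal_mul (by norm_num), ENNReal.ofReal_ofNat]
  calc ∫⁻ x in (ball z (2 * r))ᶜ, G x
      ≤ ∫⁻ x in ⋃ j, dyadicAnnulus z r (j + 1), G x := lintegral_mono_set hcover
    _ ≤ ∑' j, ∫⁻ x in dyadicAnnulus z r (j + 1), G x := lintegral_iUnion_le _ _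
    _ = ∑ j ∈ Finset.range (m + 1), ∫⁻ x in dyadicAnnulus z r (j + 1), G x :=
        tsum_eq_sum hzero
    _ ≤ ∑ j ∈ Finset.range (m + 1), 4 ^ n * I := Finset.sum_le_sum fun j _ => hterm j
    _ = ((m + 1 : ℕ) : ℝ≥0∞) * (4 ^ n * I) := by
        rw [Finset.sum_const, Finset.card_range, nsmul_eq_mul]
    _ ≤ 4 * ENNReal.ofReal (Real.log (1 + r⁻¹)) * (4 ^ n * I) := by gcongr
    _ = _ := by ring

theorem log_mul_setLIntegral_le (b : EuclideanSpace ℝ (Fin n) → 𝕜)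
    (z : EuclideanSpace ℝ (Fin n)) {r : ℝ} (hr : 0 < r) (hr1 : r < 1) :
    ENNReal.ofReal (Real.log (1 + r⁻¹)) * ∫⁻ y in ball z r, ‖b y - ballAverage b z r‖ₑ ≤
      lmoLocNorm b * volume (ball z r) := by
  rw [← meanOsc_mul_volume b _ z hr, ← mul_assoc]
  gcongr
  exact le_iSup_of_le z (le_iSup_of_le r (le_iSup_of_le hr (le_iSup_of_le hr1 le_rfl)))

theorem h1Norm_small_ball_le {b : EuclideanSpace ℝ (Fin n) → 𝕜}
    (hb : LocallyIntegrable b) {L : ℝ≥0∞} (hL0 : L ≠ 0) (hLtop : L ≠ ⊤)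
    (hL : ∀ x r, 0 < r → meanOsc b (ballAverage b x r) x r ≤ L)
    (z : EuclideanSpace ℝ (Fin n)) {r : ℝ} (hr : 0 < r) (hr1 : r < 1) :
    h1Norm ((ball z r).indicator fun w => ‖b w - ballAverage b z r‖) / volume (ball z r) ≤
      (2 * ((2 ^ n + 1) * oscThreshold n L) + ((1 + 2 ^ n) * L + L)) * 2 ^ n +
        4 * 4 ^ n * lmoLocNorm b := by
  rw [ENNReal.div_le_iff (volume_ball_ne_zero z hr) (volume_ball_ne_top z r), add_mul,
    h1Norm_indicator_eq_add b _ z r (2 * r)]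
  gcongr
  · refine (setLIntegral_grandMaximal_double_ball_le hb hL0 hLtop hL _ z hr).trans ?_
    rw [mul_assoc]
    gcongr
    · exact (enorm_ballAverage_sub_le hb _ z (by positivity)).trans (meanOsc_double_le hb hL z hr)
    · exact hL z r hr
  · refine (setLIntegral_grandMaximal_far_le b _ z hr hr1).trans ?_
    rw [mul_assoc (4 * 4 ^ n)]
    gcongr 4 * 4 ^ n * ?_
    exact log_mul_setLIntegral_le b z hr hr1

theorem lmoConst_lt_top {b : EuclideanSpace ℝ (Fin n) → 𝕜} (hb : MemBmo b)
    (hlmo : lmoLocNorm b < ⊤) : lmoConst b < ⊤ := by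
  have hbmo := hb.2
  -- The summand `1` keeps `L` nonzero, as the division by the threshold requires.
  have hL : ∀ x r, 0 < r → meanOsc b (ballAverage b x r) x r ≤ 2 * bmoNorm b + 1 :=
    fun x r hr => (meanOsc_ballAverage_le hb.1 x hr).trans le_self_add
  have hL0 : 2 * bmoNorm b + 1 ≠ 0 := by simp
  have hLtop : 2 * bmoNorm b + 1 ≠ ⊤ := by finiteness
  have hT : oscThreshold n (2 * bmoNorm b + 1) ≠ ⊤ := by
    rw [oscThreshold]
    finiteness
  generalize 2 * bmoNorm b + 1 = L at hL hL0 hLtop hT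
  refine ENNReal.add_lt_top.2 ⟨?_, ?_⟩
  · refine lt_of_le_of_lt (b := (2 * ((2 ^ n + 1) * oscThreshold n L) +
      ((1 + 2 ^ n) * L + L)) * 2 ^ n + 4 * 4 ^ n * lmoLocNorm b) ?_ (by finiteness)
    simp only [iSup_le_iff]
    exact fun z r hr hr1 => h1Norm_small_ball_le hb.1 hL0 hLtop hL z hr hr1
  · refine lt_of_le_of_lt (b := (2 * ((2 ^ n + 1) * oscThreshold n L) +
      (bmoNorm b + bmoNorm b)) * 2 ^ n) ?_ (by finiteness)
    simp only [iSup_le_iff]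
    exact fun z r hr => h1Norm_large_ball_le hb.1 hL0 hLtop hL z hr

/-! ### Lower bounds for the `h¹` norm -/

/-- Rescale one fixed bump. With `C` bounding its gradient, the factor `(1 + C)⁻¹` secures both
normalizations at once, uniformly in `x` and `t`. -/
theorem exists_testFunction_eq_const (n : ℕ) : ∃ κ : ℝ, 0 < κ ∧
    ∀ (x : EuclideanSpace ℝ (Fin n)) (t : ℝ), 0 < t → t < 1 →
      ∃ φ, IsTestFunction x t φ ∧ ∀ y ∈ ball x (t / 2), φ y = κ * (volume.real (ball x t))⁻¹ := by
  let g : ContDiffBump (0 : EuclideanSpace ℝ (Fin n)) := ⟨1 / 2, 3 / 4, by norm_num, by norm_num⟩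
  have hg : ContDiff ℝ 1 g := g.contDiff
  obtain ⟨C, hC⟩ := (g.hasCompactSupport.fderiv (𝕜 := ℝ)).exists_bound_of_continuous
    (hg.continuous_fderiv one_ne_zero)
  have hC0 : 0 ≤ C := (norm_nonneg _).trans (hC 0)
  have hκ : 0 < (1 + C)⁻¹ := by positivity
  refine ⟨(1 + C)⁻¹, hκ, fun x t ht ht1 => ?_⟩
  set V := volume.real (ball x t)
  have hV : 0 < V := ENNReal.toReal_pos (volume_ball_ne_zero x ht) (volume_ball_ne_top x t)
  set φ : EuclideanSpace ℝ (Fin n) → ℝ := fun y => (1 + C)⁻¹ * V⁻¹ * g (t⁻¹ • (y - x)) with hφ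
  have hderiv : ∀ y, HasFDerivAt φ (((1 + C)⁻¹ * V⁻¹) • (fderiv ℝ g (t⁻¹ • (y - x))).comp
      (t⁻¹ • ContinuousLinearMap.id ℝ (EuclideanSpace ℝ (Fin n)))) y := by
    intro y
    have h1 : HasFDerivAt (fun y => t⁻¹ • (y - x))
        (t⁻¹ • ContinuousLinearMap.id ℝ (EuclideanSpace ℝ (Fin n))) y :=
      ((hasFDerivAt_id y).sub_const x).const_smul t⁻¹
    exact (((hg.differentiable one_ne_zero) _).hasFDerivAt.comp y h1).const_mul _
  refine ⟨φ, ⟨?_, ht, ht1, ?_, ?_, ?_⟩, ?_⟩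
  · exact contDiff_const.mul (hg.comp ((contDiff_id.sub contDiff_const).const_smul t⁻¹))
  · have hsub : tsupport φ ⊆ closedBall x (3 / 4 * t) := by
      refine closure_minimal (fun y hy => ?_) isClosed_closedBall
      have h1 : t⁻¹ • (y - x) ∈ Function.support g := fun h => hy (by simp only [hφ, h, mul_zero])
      rw [g.support_eq, mem_ball_zero_iff, norm_smul, norm_inv, Real.norm_of_nonneg ht.le,
        inv_mul_lt_iff₀ ht] at h1
      rw [mem_closedBall, dist_eq_norm]
      change _ < t * (3 / 4) at h1
      linarith
    exact hsub.trans (closedBall_subset_ball (by linarith))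
  · intro y
    have h1 : |g (t⁻¹ • (y - x))| ≤ 1 := by
      rw [abs_of_nonneg g.nonneg]
      exact g.le_one
    have h2 : (1 + C)⁻¹ ≤ 1 := inv_le_one_of_one_le₀ (by linarith)
    rw [hφ, abs_mul, abs_of_nonneg (by positivity)]
    calc (1 + C)⁻¹ * V⁻¹ * |g (t⁻¹ • (y - x))| ≤ 1 * V⁻¹ * 1 := by gcongr
      _ = V⁻¹ := by ring
  · intro y
    rw [(hderiv y).fderiv, norm_smul, Real.norm_of_nonneg (by positivity)]
    have h1 : ‖t⁻¹ • ContinuousLinearMap.id ℝ (EuclideanSpace ℝ (Fin n))‖ ≤ t⁻¹ := by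
      rw [norm_smul, Real.norm_of_nonneg (by positivity)]
      exact mul_le_of_le_one_right (by positivity) ContinuousLinearMap.norm_id_le
    calc (1 + C)⁻¹ * V⁻¹ * ‖(fderiv ℝ g (t⁻¹ • (y - x))).comp
          (t⁻¹ • ContinuousLinearMap.id ℝ (EuclideanSpace ℝ (Fin n)))‖
        ≤ (1 + C)⁻¹ * V⁻¹ * ((1 + C) * t⁻¹) := by
          gcongr
          refine (ContinuousLinearMap.opNorm_comp_le _ _).trans ?_
          gcongr
          linarith [hC (t⁻¹ • (y - x))]
      _ = (t * V)⁻¹ := by field_simp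
  · intro y hy
    have h1 : g (t⁻¹ • (y - x)) = 1 := by
      refine g.one_of_mem_closedBall ?_
      rw [mem_closedBall_zero_iff, norm_smul, norm_inv, Real.norm_of_nonneg ht.le,
        inv_mul_le_iff₀ ht]
      rw [mem_ball, dist_eq_norm] at hy
      change _ ≤ t * (1 / 2)
      linarith
    rw [hφ]
    simp only [h1, mul_one]

/-- The test function is constant on the ball carrying the nonnegative function, so the pairing is
exactly a multiple of its integral. -/
theorem ofReal_mul_le_grandMaximal {b : EuclideanSpace ℝ (Fin n) → 𝕜} (hb : LocallyIntegrable b)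
    (c : 𝕜) {κ : ℝ} {x z : EuclideanSpace ℝ (Fin n)} {r t : ℝ} (ht : 0 < t)
    {φ : EuclideanSpace ℝ (Fin n) → ℝ} (hφ : IsTestFunction x t φ)
    (hφc : ∀ y ∈ ball x (t / 2), φ y = κ * (volume.real (ball x t))⁻¹)
    (hsub : ball z r ⊆ ball x (t / 2)) :
    ENNReal.ofReal κ * ((∫⁻ y in ball z r, ‖b y - c‖ₑ) / volume (ball z t)) ≤
      grandMaximal ((ball z r).indicator fun w => ‖b w - c‖) x := by
  set f := (ball z r).indicator fun w => ‖b w - c‖ with hf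
  set V := volume.real (ball x t) with hVdef
  have hV : 0 < V := ENNReal.toReal_pos (volume_ball_ne_zero x ht) (volume_ball_ne_top x t)
  have hint : IntegrableOn (fun y => b y - c) (ball z r) :=
    (integrableOn_ball hb z r).sub (integrableOn_const (volume_ball_ne_top z r))
  have h1 : ∫ y, f y * φ y = (∫ y in ball z r, ‖b y - c‖) * (κ * V⁻¹) := by
    rw [← integral_indicator measurableSet_ball, ← integral_mul_const]
    refine integral_congr_ae (Filter.Eventually.of_forall fun y => ?_)
    by_cases hy : y ∈ ball z r
    · simp only [hφc y (hsub hy)]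
      rfl
    · simp only [hf, indicator_of_notMem hy, zero_mul]
  have h2 : ENNReal.ofReal κ * ((∫⁻ y in ball z r, ‖b y - c‖ₑ) / volume (ball z t)) ≤
      ‖∫ y, f y * φ y‖ₑ := by
    rw [h1, enorm_mul, enorm_mul, ← ofReal_integral_norm_eq_lintegral_enorm hint,
      ← Real.enorm_of_nonneg (integral_nonneg fun _ => norm_nonneg _), ENNReal.div_eq_inv_mul,
      Real.enorm_of_nonneg (inv_pos.2 hV).le, ENNReal.ofReal_inv_of_pos hV, hVdef, Measure.real,
      ENNReal.ofReal_toReal (volume_ball_ne_top x t), Measure.addHaar_ball_center _ x,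
      Measure.addHaar_ball_center _ z]
    calc _ ≤ ‖κ‖ₑ * _ := by gcongr; exact Real.ofReal_le_enorm κ
      _ = _ := by ring
  exact h2.trans (le_iSup_of_le t (le_iSup_of_le φ (le_iSup_of_le hφ le_rfl)))

/-- Doubling the radius multiplies the volume by `2 ^ n ≥ 2`; this is where positive dimension
enters. -/
theorem volume_ball_le_volume_dyadicAnnulus (hn : 1 ≤ n)
    (z : EuclideanSpace ℝ (Fin n)) {r : ℝ} (hr : 0 < r) (k : ℕ) :
    volume (ball z (2 ^ k * r)) ≤ volume (dyadicAnnulus z r k) := by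
  have hk : 0 < 2 ^ k * r := by positivity
  rw [dyadicAnnulus, measure_sdiff (ball_subset_ball (by rw [pow_succ]; linarith))
    measurableSet_ball.nullMeasurableSet (volume_ball_ne_top z _)]
  refine ENNReal.le_sub_of_add_le_left (volume_ball_ne_top z _) ?_
  have := volume_ball_natCast_mul z z two_pos (2 ^ k * r)
  push_cast at this
  rw [pow_succ', mul_assoc, this, ← two_mul]
  gcongr
  calc (2 : ℝ≥0∞) = 2 ^ 1 := (pow_one _).symm
    _ ≤ 2 ^ n := pow_le_pow_right₀ one_le_two hn

theorem pairwise_disjoint_dyadicAnnulus (z : EuclideanSpace ℝ (Fin n)) {r : ℝ} (hr : 0 < r) :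
    Pairwise (Function.onFun Disjoint (dyadicAnnulus z r)) := by
  rw [pairwise_disjoint_on]
  intro i j hij
  refine disjoint_left.2 fun x hi hj => hj.2 (ball_subset_ball ?_ hi.1)
  gcongr
  · exact one_le_two
  · exact hij

theorem natCast_mul_setLIntegral_le_h1Norm (hn : 1 ≤ n) {b : EuclideanSpace ℝ (Fin n) → 𝕜}
    (hb : LocallyIntegrable b) (c : 𝕜) {κ : ℝ}
    (hκ : ∀ (x : EuclideanSpace ℝ (Fin n)) (t : ℝ), 0 < t → t < 1 →
      ∃ φ, IsTestFunction x t φ ∧ ∀ y ∈ ball x (t / 2), φ y = κ * (volume.real (ball x t))⁻¹)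
    (z : EuclideanSpace ℝ (Fin n)) {r : ℝ} (hr : 0 < r) {N : ℕ}
    (hN : ∀ k < N, 2 ^ (k + 3) * r < 1) :
    N * (ENNReal.ofReal κ * ∫⁻ y in ball z r, ‖b y - c‖ₑ) ≤
      8 ^ n * h1Norm ((ball z r).indicator fun w => ‖b w - c‖) := by
  set G := grandMaximal ((ball z r).indicator fun w => ‖b w - c‖) with hG
  set I := ∫⁻ y in ball z r, ‖b y - c‖ₑ with hI
  have hterm : ∀ k ∈ Finset.range N, ENNReal.ofReal κ * I ≤
      8 ^ n * ∫⁻ x in dyadicAnnulus z r k, G x := by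
    intro k hk
    have hk0 : 0 < 2 ^ k * r := by positivity
    have hkr : r ≤ 2 ^ k * r := le_mul_of_one_le_left hr.le (one_le_pow₀ one_le_two)
    -- Scale `2 ^ (k + 3) * r` is the first dyadic one whose half-ball about any point of the
    -- annulus must contain `B(z, r)`: half of it is `4 * 2 ^ k * r`, and at most `3 * 2 ^ k * r` is
    -- needed.
    have ht : 0 < 2 ^ (k + 3) * r := by positivity
    have hv : volume (ball z (2 ^ (k + 3) * r)) = 8 ^ n * volume (ball z (2 ^ k * r)) := by
      have := volume_ball_natCast_mul z z (m := 8) (by norm_num) (2 ^ k * r)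
      push_cast at this
      rw [← this]
      congr 2
      ring
    have hle : ENNReal.ofReal κ * (I / volume (ball z (2 ^ (k + 3) * r))) *
        volume (dyadicAnnulus z r k) ≤ ∫⁻ x in dyadicAnnulus z r k, G x := by
      rw [← setLIntegral_const]
      refine setLIntegral_mono' (measurableSet_dyadicAnnulus z r k) fun x hx => ?_
      obtain ⟨φ, hφ, hφc⟩ := hκ x _ ht (hN k (Finset.mem_range.1 hk))
      refine ofReal_mul_le_grandMaximal hb c ht hφ hφc (ball_subset_ball' ?_)
      have h1 := hx.1
      rw [mem_ball, pow_succ, dist_comm] at h1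
      have h2 : (2 : ℝ) ^ (k + 3) * r / 2 = 4 * (2 ^ k * r) := by ring
      rw [h2]
      linarith
    calc ENNReal.ofReal κ * I
        = ENNReal.ofReal κ * (I / volume (ball z (2 ^ (k + 3) * r)) *
            volume (ball z (2 ^ (k + 3) * r))) := by
          rw [ENNReal.div_mul_cancel (volume_ball_ne_zero z ht) (volume_ball_ne_top z _)]
      _ = 8 ^ n * (ENNReal.ofReal κ * (I / volume (ball z (2 ^ (k + 3) * r))) *
            volume (ball z (2 ^ k * r))) := by
          rw [hv]
          ring
      _ ≤ 8 ^ n * (ENNReal.ofReal κ * (I / volume (ball z (2 ^ (k + 3) * r))) *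
            volume (dyadicAnnulus z r k)) := by
          gcongr 8 ^ n * (_ * ?_)
          exact volume_ball_le_volume_dyadicAnnulus hn z hr k
      _ ≤ _ := by gcongr
  calc N * (ENNReal.ofReal κ * I)
      = ∑ k ∈ Finset.range N, ENNReal.ofReal κ * I := by
        rw [Finset.sum_const, Finset.card_range, nsmul_eq_mul]
    _ ≤ ∑ k ∈ Finset.range N, 8 ^ n * ∫⁻ x in dyadicAnnulus z r k, G x := Finset.sum_le_sum hterm
    _ = 8 ^ n * ∫⁻ x in ⋃ k ∈ Finset.range N, dyadicAnnulus z r k, G x := by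
        rw [← Finset.mul_sum, lintegral_biUnion_finset
          ((pairwise_disjoint_dyadicAnnulus z hr).set_pairwise _)
          fun k _ => measurableSet_dyadicAnnulus z r k]
    _ ≤ 8 ^ n * ∫⁻ x, G x := by
        gcongr
        exact Measure.restrict_le_self

theorem lmoLocNorm_lt_top (hn : 1 ≤ n) {b : EuclideanSpace ℝ (Fin n) → 𝕜} (hb : MemBmo b)
    (hA : lmoConst b < ⊤) : lmoLocNorm b < ⊤ := by
  obtain ⟨κ, hκ0, hκ⟩ := exists_testFunction_eq_const n
  have hbmo := hb.2
  have hκ' : ENNReal.ofReal κ ≠ 0 := by simpa using hκ0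
  refine lt_of_le_of_lt (b := (ENNReal.ofReal κ)⁻¹ * (8 ^ n * lmoConst b) + 5 * (2 * bmoNorm b))
    ?_ (by finiteness)
  simp only [lmoLocNorm, iSup_le_iff]
  intro z r hr hr1
  obtain ⟨m, hm1, hm2⟩ := exists_two_pow_near_inv hr hr1
  have hlog : ENNReal.ofReal (Real.log (1 + r⁻¹)) ≤ ((m - 3 : ℕ) : ℝ≥0∞) + 5 := by
    have hri : 1 < r⁻¹ := (one_lt_inv₀ hr).2 hr1
    have h1 : Real.log (1 + r⁻¹) ≤ (m + 2 : ℕ) * Real.log 2 := by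
      rw [← Real.log_pow]
      refine Real.log_le_log (by positivity) ?_
      rw [← div_lt_iff₀ hr, one_div] at hm2
      rw [show m + 2 = m + 1 + 1 from rfl, pow_succ]
      linarith
    have h2 : Real.log (1 + r⁻¹) ≤ (m + 2 : ℕ) :=
      h1.trans (mul_le_of_le_one_right (by positivity) (by linarith [Real.log_two_lt_d9]))
    calc ENNReal.ofReal (Real.log (1 + r⁻¹)) ≤ ENNReal.ofReal (m + 2 : ℕ) :=
          ENNReal.ofReal_le_ofReal h2
      _ = ((m + 2 : ℕ) : ℝ≥0∞) := ENNReal.ofReal_natCast _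
      _ ≤ ((m - 3 + 5 : ℕ) : ℝ≥0∞) := by
          rw [Nat.cast_le]
          omega
      _ = _ := by push_cast; rfl
  have hN : ∀ k < m - 3, 2 ^ (k + 3) * r < 1 := by
    intro k hk
    calc 2 ^ (k + 3) * r < 2 ^ m * r := by
          gcongr
          · exact one_lt_two
          · omega
      _ ≤ 1 := hm1
  have hlow := natCast_mul_setLIntegral_le_h1Norm hn hb.1 (ballAverage b z r) hκ z hr hN
  have hconst : h1Norm ((ball z r).indicator fun w => ‖b w - ballAverage b z r‖) /
      volume (ball z r) ≤ lmoConst b := by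
    refine le_trans ?_ le_self_add
    refine le_iSup_of_le z (le_iSup_of_le r ?_)
    exact le_iSup₂_of_le hr hr1 le_rfl
  change _ * meanOsc b (ballAverage b z r) z r ≤ _
  calc ENNReal.ofReal (Real.log (1 + r⁻¹)) * meanOsc b (ballAverage b z r) z r
      ≤ (((m - 3 : ℕ) : ℝ≥0∞) + 5) * meanOsc b (ballAverage b z r) z r := by gcongr
    _ = ((m - 3 : ℕ) : ℝ≥0∞) * meanOsc b (ballAverage b z r) z r
          + 5 * meanOsc b (ballAverage b z r) z r := add_mul _ _ _
    _ ≤ _ := by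
      refine add_le_add ?_ ?_
      · rw [← ENNReal.div_eq_inv_mul, ENNReal.le_div_iff_mul_le (Or.inl hκ')
          (Or.inl ENNReal.ofReal_ne_top)]
        calc ((m - 3 : ℕ) : ℝ≥0∞) * meanOsc b (ballAverage b z r) z r * ENNReal.ofReal κ
            = ((m - 3 : ℕ) * (ENNReal.ofReal κ *
                ∫⁻ y in ball z r, ‖b y - ballAverage b z r‖ₑ)) / volume (ball z r) := by
              rw [meanOsc]
              simp only [div_eq_mul_inv]
              ring
          _ ≤ (8 ^ n * h1Norm ((ball z r).indicator fun w => ‖b w - ballAverage b z r‖)) /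
                volume (ball z r) := by gcongr
          _ ≤ 8 ^ n * lmoConst b := by
              rw [mul_div_assoc]
              gcongr
      · gcongr
        exact meanOsc_ballAverage_le hb.1 z hr

end LocalHardy

theorem corollary4p11 {𝕜 : Type*} [RCLike 𝕜] {n : ℕ} (hn : 1 ≤ n)
    (b : EuclideanSpace ℝ (Fin n) → 𝕜) (hb : LocalHardy.MemBmo b) :
    LocalHardy.MemLmo b ↔ LocalHardy.lmoConst b < ⊤ :=
  ⟨fun h => LocalHardy.lmoConst_lt_top hb h.1.2,
    fun h => ⟨⟨hb.1, LocalHardy.lmoLocNorm_lt_top hn hb h⟩, hb⟩⟩
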